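/- A group action on $[n]=\{1,\dots,n\}$ is a set $G$ of permutations of $[n]$ that is a group under composition. Identify a function $[n]\to[n]$ with a string in $[n]^n$, so that $G\subseteq[n]^n$, and let $D_{n,r}\subseteq[n]^n$ be the set of strings in which at most $r$ distinct symbols occur. For $r<n$ let $\mathrm{cost}(G,r)$ be the bounded-error quantum query complexity $Q_{1/3}(f)$ of the partial Boolean function $f$ with domain $G\cup D_{n,r}$, $f=1$ on $G$ and $f=0$ on $D_{n,r}$. That is, it is the least number of queries $|i,b,w\rangle\mapsto|i,b+x_i \bmod n,w\rangle$ made by a quantum query algorithm that computes $f$ with worst-case error at most $1/3$. For $r\ge n$ set $\mathrm{cost}(G,r)=\infty$. **Theorem.** Let $G$ and $H$ be group actions on $[n]$, let $k$ be a positive integer with $k\le n$, and suppose that for all $i_1,\dots,i_k,j_1,\dots,j_k\in[n]$ (not necessarily distinct) \[\left|\Pr_{\pi\leftarrow G}[\forall \ell\;\pi(i_\ell)=j_\ell]-\Pr_{\pi\leftarrow H}[\forall \ell\;\pi(i_\ell)=j_\ell]\right|\le n^{-10k},\] where $\pi$ is drawn uniformly from $G$, respectively $H$. Then for every integer $r\ge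 0$ \[\mathrm{cost}(H,r)\ge c\cdot\min\{k,\mathrm{cost}(G,r)\},\] where $c>0$ is a universal constant (independent of $n,k,r,G,H$). In particular, for all real constants $a_1,b_1,a_2,b_2>0$ there are real constants $a,b>0$, depending only on them, such that for all $n,k,r,G,H$ as above: if $k\ge b_1n^{a_1}$ and $\mathrm{cost}(G,r)\ge b_2r^{a_2}$, then $\mathrm{cost}(H,r)\ge b\,r^{a}$. -/

import Mathlib

open scoped ENNReal

namespace QuerySym

/-- The basis states `|i, b, w⟩` of a quantum query algorithm on strings of length `n` over the
alphabet `Fin m`: a query index `i`, an answer register `b`, and a workspace state `w`. -/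
abbrev BasisState (n m : ℕ) (W : Type) : Type := Fin n × Fin m × W

/-- The matrix of the oracle `O_x |i, b, w⟩ = |i, b + x_i, w⟩`, with addition modulo `m`
(the addition of `Fin m`). -/
def oracle {n m : ℕ} {W : Type} [DecidableEq W] (x : Fin n → Fin m) :
    Matrix (BasisState n m W) (BasisState n m W) ℂ :=
  Matrix.of fun p q => if p = (q.1, q.2.1 + x q.1, q.2.2) then 1 else 0

/-- A quantum query algorithm on strings in `(Fin m)^n` (with `n` and `m` positive): a finite
workspace, an initial basis state, input-independent unitaries `U_0, U_1, …, U_T`, where `T` is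
the number of queries, and a Boolean read off from a measurement of the final state in the
computational basis. Only the first `T + 1` members of the sequence `U` are used. -/
structure QuantumAlgorithm (n m : ℕ) where
  W : Type
  [fintypeW : Fintype W]
  [decidableEqW : DecidableEq W]
  queries : ℕ
  start : BasisState n m W
  U : ℕ → Matrix.unitaryGroup (BasisState n m W) ℂ
  output : BasisState n m W → Bool

attribute [instance] QuantumAlgorithm.fintypeW QuantumAlgorithm.decidableEqW

namespace QuantumAlgorithm

variable {n m : ℕ}

/-- The state `U_t O_x U_{t-1} ⋯ O_x U_0 |start⟩` after `t` queries to `x`. -/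
def state (A : QuantumAlgorithm n m) (x : Fin n → Fin m) : ℕ → (BasisState n m A.W → ℂ)
  | 0 => Matrix.mulVec (A.U 0 : Matrix _ _ ℂ) (Pi.single A.start 1)
  | t + 1 => Matrix.mulVec (A.U (t + 1) : Matrix _ _ ℂ)
      (Matrix.mulVec (oracle x) (A.state x t))

/-- The probability that the algorithm outputs `b` on input `x`. -/
noncomputable def outputProb (A : QuantumAlgorithm n m) (x : Fin n → Fin m) (b : Bool) : ℝ :=
  ∑ q : BasisState n m A.W, if A.output q = b then ‖A.state x A.queries q‖ ^ 2 else 0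

/-- The algorithm computes the partial Boolean function `f` to worst-case error `ε`. -/
def Computes (A : QuantumAlgorithm n m) (ε : ℝ) (f : (Fin n → Fin m) →. Bool) : Prop :=
  ∀ x, ∀ b ∈ f x, 1 - ε ≤ A.outputProb x b

end QuantumAlgorithm

/-- The quantum query complexity `Q_ε(f)` of a partial Boolean function `f`. -/
noncomputable def quantumQueryComplexity {n m : ℕ} (ε : ℝ) (f : (Fin n → Fin m) →. Bool) : ℕ∞ :=
  ⨅ (A : QuantumAlgorithm n m) (_ : A.Computes ε f), (A.queries : ℕ∞)

/-- The strings of `[n]^n` that are the permutations in `G`. -/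
def permStrings {n : ℕ} (G : Subgroup (Equiv.Perm (Fin n))) : Set (Fin n → Fin n) :=
  {x | ∃ π ∈ G, x = ⇑π}

/-- The small-range strings `D_{n,r}`: at most `r` distinct symbols occur. -/
def smallRange (n r : ℕ) : Set (Fin n → Fin n) :=
  {x | (Set.range x).ncard ≤ r}

open Classical in
/-- The partial function with domain `G ∪ D_{n,r}` that is `1` on `G` and `0` on the rest of its
domain. For `r < n` the sets `G` and `D_{n,r}` are disjoint. -/
noncomputable def distinguish {n : ℕ} (G : Subgroup (Equiv.Perm (Fin n))) (r : ℕ) :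
    (Fin n → Fin n) →. Bool :=
  fun x => ⟨x ∈ permStrings G ∪ smallRange n r, fun _ => decide (x ∈ permStrings G)⟩

/-- `cost_ε(G, r)`: the number of quantum queries needed to distinguish `G` from `D_{n,r}` to
worst-case error `ε`, and `∞` if `r ≥ n`. -/
noncomputable def costErr {n : ℕ} (ε : ℝ) (G : Subgroup (Equiv.Perm (Fin n))) (r : ℕ) : ℕ∞ :=
  if r < n then quantumQueryComplexity ε (distinguish G r) else ⊤

/-- `cost(G, r) = cost_{1/3}(G, r)`. -/
noncomputable def cost {n : ℕ} (G : Subgroup (Equiv.Perm (Fin n))) (r : ℕ) : ℕ∞ :=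
  costErr (1 / 3) G r

/-- The probability that a uniformly random `π ∈ G` satisfies `π (i ℓ) = j ℓ` for all `ℓ`. -/
noncomputable def mapProb {n k : ℕ} (G : Subgroup (Equiv.Perm (Fin n))) (i j : Fin k → Fin n) :
    ℝ :=
  (Nat.card {π : G // ∀ l, (π : Equiv.Perm (Fin n)) (i l) = j l} : ℝ) / (Nat.card G : ℝ)

/-- For all `k` positions and all `k` targets (repetitions allowed), the probabilities for `G` and
for `H` that the positions are mapped to the targets differ by at most `n^{-10k}`. -/
def SimilarLooking {n : ℕ} (k : ℕ) (G H : Subgroup (Equiv.Perm (Fin n))) : Prop :=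
  ∀ i j : Fin k → Fin n, |mapProb G i j - mapProb H i j| ≤ (n : ℝ) ^ (-(10 * (k : ℤ)))

end QuerySym

/-!
Let `A` distinguish `H` from the small-range strings with `T ≤ k / 2` queries. Expanding every query
over the position asked and the answer received writes the final state as a sum of
input-independent path vectors of norm at most `1` (`pathState`), where an input `x` selects the
paths whose answers agree with it. Hence the acceptance probability is a sum over `2T`-tuples `i` of
positions of coefficients `β i (x ∘ i)` of modulus at most `1` (`exists_outputProb_eq_sum`), and its
average over a group is a combination of at most `n ^ (4T)` of the probabilities `mapProb`. For
similar-looking `G` and `H` these averages differ by at most `n ^ (2k) * n ^ (-10k) ≤ 1 / 256`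
once `2 ≤ n` (`SimilarLooking.average_outputProb_sub_le`).

An algorithm for `G` runs `A` on `x ∘ τ` for a uniform `τ ∈ G` held in superposition in the
workspace (`exists_average`). If `x ∈ G` then `x ∘ τ` is uniform on `G`, so acceptance has
probability at least `2 / 3 - 1 / 256`; if `x` has small range, so has `x ∘ τ`, and rejection has
probability at least `2 / 3`. The disjunction of two conjunctions of independent runs brings the
error back to `1 / 3` with four times as many queries (`exists_amplified`). Thus
`min k (cost G r) ≤ 4 * cost H r` (`min_cost_le`). The polynomial bound follows because `r < n`
whenever `cost H r` is finite.
-/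

namespace QuerySym

open scoped Kronecker

/-! ### Unitary matrices and tensor products -/

/-- Relabelling rows and columns, possibly in different ways, preserves unitarity. -/
theorem submatrix_mem_unitaryGroup {ι κ : Type*} [Fintype ι] [DecidableEq ι] [Fintype κ]
    [DecidableEq κ] {M : Matrix ι ι ℂ} (hM : M ∈ Matrix.unitaryGroup ι ℂ) (e f : κ ≃ ι) :
    M.submatrix e f ∈ Matrix.unitaryGroup κ ℂ := by
  rw [Matrix.mem_unitaryGroup_iff] at hM ⊢
  rw [Matrix.star_eq_conjTranspose] at hM ⊢
  rw [Matrix.conjTranspose_submatrix, Matrix.submatrix_mul_equiv, hM, Matrix.submatrix_one_equiv]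

theorem kronecker_mem_unitaryGroup {ι κ : Type*} [Fintype ι] [DecidableEq ι] [Fintype κ]
    [DecidableEq κ] {M : Matrix ι ι ℂ} {N : Matrix κ κ ℂ} (hM : M ∈ Matrix.unitaryGroup ι ℂ)
    (hN : N ∈ Matrix.unitaryGroup κ ℂ) : M ⊗ₖ N ∈ Matrix.unitaryGroup (ι × κ) ℂ :=
  Matrix.kronecker_mem_unitary hM hN

theorem sum_norm_sq_mulVec {ι : Type*} [Fintype ι] [DecidableEq ι] {M : Matrix ι ι ℂ}
    (hM : M ∈ Matrix.unitaryGroup ι ℂ) (v : ι → ℂ) :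
    ∑ i, ‖M.mulVec v i‖ ^ 2 = ∑ i, ‖v i‖ ^ 2 := by
  have key (u : ι → ℂ) : ((∑ i, ‖u i‖ ^ 2 : ℝ) : ℂ) = dotProduct (star u) u := by
    simp [dotProduct, Complex.conj_mul']
  have h : (star (M.mulVec v)) ⬝ᵥ (M.mulVec v) = star v ⬝ᵥ v := by
    rw [Matrix.mem_unitaryGroup_iff', Matrix.star_eq_conjTranspose] at hM
    rw [Matrix.star_mulVec, ← Matrix.dotProduct_mulVec, Matrix.mulVec_mulVec, hM,
      Matrix.one_mulVec]
  rw [← key, ← key] at h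
  exact_mod_cast h

/-- Every unit vector is a column of some unitary matrix. -/
theorem exists_unitary_column {ι : Type*} [Fintype ι] [DecidableEq ι] (i₀ : ι) (v : ι → ℂ)
    (hv : ∑ i, ‖v i‖ ^ 2 = 1) :
    ∃ Q ∈ Matrix.unitaryGroup ι ℂ, ∀ i, Q i i₀ = v i := by
  have hunit : ‖WithLp.toLp 2 v‖ = 1 := by
    rw [EuclideanSpace.norm_eq]; simp [hv]
  obtain ⟨b, hb⟩ := Orthonormal.exists_orthonormalBasis_extension_of_card_eq (𝕜 := ℂ)
    (E := EuclideanSpace ℂ ι) (ι := ι) (by simp) (v := fun _ => WithLp.toLp 2 v) (s := {i₀})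
    (by
      constructor
      · intro _; exact hunit
      · intro a b hab; exact (hab (Subsingleton.elim a b)).elim)
  refine ⟨(EuclideanSpace.basisFun ι ℂ).toBasis.toMatrix b,
    (EuclideanSpace.basisFun ι ℂ).toMatrix_orthonormalBasis_mem_unitary b, fun i => ?_⟩
  simp [Module.Basis.toMatrix_apply, hb i₀ rfl]

theorem kronecker_submatrix_mulVec {ι κ σ : Type*} [Fintype ι] [Fintype κ] [Fintype σ]
    (M : Matrix ι ι ℂ) (N : Matrix κ κ ℂ) (e f : σ ≃ ι × κ) (u : ι → ℂ) (v : κ → ℂ) :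
    ((M ⊗ₖ N).submatrix e f).mulVec (fun p => u (f p).1 * v (f p).2) =
      fun p => M.mulVec u (e p).1 * N.mulVec v (e p).2 := by
  ext p
  simp only [Matrix.mulVec, dotProduct, Matrix.submatrix_apply, Matrix.kroneckerMap_apply]
  rw [Finset.sum_mul_sum, ← Fintype.sum_prod_type', ← f.sum_comp]
  exact Finset.sum_congr rfl fun q _ => by ring

theorem kronecker_one_submatrix_mulVec {ι κ σ : Type*} [Fintype ι] [Fintype κ] [DecidableEq κ]
    [Fintype σ] (M : Matrix ι ι ℂ) (e : σ ≃ ι × κ) (v : κ → ι → ℂ) :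
    ((M ⊗ₖ (1 : Matrix κ κ ℂ)).submatrix e e).mulVec (fun p => v (e p).2 (e p).1) =
      fun p => M.mulVec (v (e p).2) (e p).1 := by
  ext p
  simp only [Matrix.mulVec, dotProduct, Matrix.submatrix_apply, Matrix.kroneckerMap_apply]
  rw [e.sum_comp (fun q : ι × κ => M (e p).1 q.1 * (1 : Matrix κ κ ℂ) (e p).2 q.2 * v q.2 q.1),
    Fintype.sum_prod_type]
  simp [Matrix.one_apply]

/-! ### The oracle -/

theorem oracle_mulVec {n m : ℕ} [NeZero m] {W : Type} [Fintype W] [DecidableEq W]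
    (x : Fin n → Fin m) (v : BasisState n m W → ℂ) (p : BasisState n m W) :
    (oracle x).mulVec v p = v (p.1, p.2.1 - x p.1, p.2.2) := by
  obtain ⟨i, b, w⟩ := p
  simp only [Matrix.mulVec, dotProduct, oracle, Matrix.of_apply]
  rw [Finset.sum_eq_single (i, b - x i, w)]
  · simp
  · rintro ⟨i', b', w'⟩ - hne
    rw [if_neg, zero_mul]
    rintro h
    simp only [Prod.mk.injEq] at h
    obtain ⟨rfl, rfl, rfl⟩ := h
    simp at hne
  · simp

theorem sum_norm_sq_oracle_mulVec {n m : ℕ} [NeZero m] {W : Type} [Fintype W] [DecidableEq W]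
    (x : Fin n → Fin m) (v : BasisState n m W → ℂ) :
    ∑ p, ‖(oracle x).mulVec v p‖ ^ 2 = ∑ p, ‖v p‖ ^ 2 := by
  simp only [oracle_mulVec, Fintype.sum_prod_type]
  refine Finset.sum_congr rfl fun i _ => ?_
  exact (Equiv.subRight (x i)).sum_comp fun b => ∑ w, ‖v (i, b, w)‖ ^ 2

namespace QuantumAlgorithm

variable {n m : ℕ}

/-- The state after a number of queries of the algorithm with unitaries `U` and initial basis state
`s`, with the workspace `W` as an explicit type rather than a field of a structure. -/
def evolve {W : Type} [Fintype W] [DecidableEq W]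
    (U : ℕ → Matrix.unitaryGroup (BasisState n m W) ℂ) (s : BasisState n m W) (x : Fin n → Fin m) :
    ℕ → BasisState n m W → ℂ
  | 0 => (U 0 : Matrix _ _ ℂ).mulVec (Pi.single s 1)
  | t + 1 => (U (t + 1) : Matrix _ _ ℂ).mulVec ((oracle x).mulVec (evolve U s x t))

theorem state_eq_evolve (A : QuantumAlgorithm n m) (x : Fin n → Fin m) (t : ℕ) :
    A.state x t = evolve A.U A.start x t := by
  induction t with
  | zero => rfl
  | succ t ih => rw [state, evolve, ih]

theorem outputProb_mk {W : Type} [Fintype W] [DecidableEq W] (T : ℕ) (s : BasisState n m W)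
    (U : ℕ → Matrix.unitaryGroup (BasisState n m W) ℂ) (o : BasisState n m W → Bool)
    (x : Fin n → Fin m) (b : Bool) :
    (QuantumAlgorithm.mk W T s U o).outputProb x b =
      ∑ q, if o q = b then ‖evolve U s x T q‖ ^ 2 else 0 := by
  rw [outputProb, state_eq_evolve]

theorem sum_norm_sq_state [NeZero m] (A : QuantumAlgorithm n m) (x : Fin n → Fin m) (t : ℕ) :
    ∑ p, ‖A.state x t p‖ ^ 2 = 1 := by
  induction t with
  | zero =>
    rw [state, sum_norm_sq_mulVec (A.U 0).2]
    simp [Pi.single_apply, apply_ite]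
  | succ t ih => rw [state, sum_norm_sq_mulVec (A.U (t + 1)).2, sum_norm_sq_oracle_mulVec, ih]

theorem outputProb_add_outputProb [NeZero m] (A : QuantumAlgorithm n m) (x : Fin n → Fin m) :
    A.outputProb x true + A.outputProb x false = 1 := by
  rw [← A.sum_norm_sq_state x A.queries, outputProb, outputProb, ← Finset.sum_add_distrib]
  refine Finset.sum_congr rfl fun p _ => ?_
  cases A.output p <;> simp

theorem outputProb_nonneg (A : QuantumAlgorithm n m) (x : Fin n → Fin m) (b : Bool) :
    0 ≤ A.outputProb x b :=
  Finset.sum_nonneg fun p _ => by split_ifs <;> positivity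

/-! ### Running two algorithms one after the other -/

/-- The basis states of a joint machine, whose workspace stores a basis state of the second
machine, seen as pairs while the query registers `i, b` belong to the first machine. -/
def firstActive (n m : ℕ) (V W : Type) :
    BasisState n m (V × BasisState n m W) ≃ BasisState n m V × BasisState n m W where
  toFun p := ((p.1, p.2.1, p.2.2.1), p.2.2.2)
  invFun q := (q.1.1, q.1.2.1, q.1.2.2, q.2)
  left_inv _ := rfl
  right_inv _ := rfl

/-- The same basis states seen as pairs while the query registers belong to the second machine,
those of the first being parked in the workspace. -/
def secondActive (n m : ℕ) (V W : Type) :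
    BasisState n m (V × BasisState n m W) ≃ BasisState n m V × BasisState n m W where
  toFun p := ((p.2.2.2.1, p.2.2.2.2.1, p.2.2.1), (p.1, p.2.1, p.2.2.2.2.2))
  invFun q := (q.2.1, q.2.2.1, q.1.2.2, q.1.1, q.1.2.1, q.2.2.2)
  left_inv _ := rfl
  right_inv _ := rfl

/-- The tensor product of two unitaries, with its rows and columns relabelled. -/
def kroneckerUnitary {ι κ σ : Type*} [Fintype ι] [DecidableEq ι] [Fintype κ] [DecidableEq κ]
    [Fintype σ] [DecidableEq σ] (e f : σ ≃ ι × κ) (M : Matrix.unitaryGroup ι ℂ)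
    (N : Matrix.unitaryGroup κ ℂ) : Matrix.unitaryGroup σ ℂ :=
  ⟨((M : Matrix ι ι ℂ) ⊗ₖ (N : Matrix κ κ ℂ)).submatrix e f,
    submatrix_mem_unitaryGroup (kronecker_mem_unitaryGroup M.2 N.2) e f⟩

/-- The unitaries of the joint machine that runs `A` and then `B`. The last unitary of `A` and the
first one of `B` are merged into one step, which also exchanges the query registers. -/
def combineU (A B : QuantumAlgorithm n m) (t : ℕ) :
    Matrix.unitaryGroup (BasisState n m (A.W × BasisState n m B.W)) ℂ :=
  if t < A.queries then
    kroneckerUnitary (firstActive n m A.W B.W) (firstActive n m A.W B.W) (A.U t) 1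
  else if t = A.queries then
    kroneckerUnitary (secondActive n m A.W B.W) (firstActive n m A.W B.W) (A.U t) (B.U 0)
  else
    kroneckerUnitary (secondActive n m A.W B.W) (secondActive n m A.W B.W) 1
      (B.U (t - A.queries))

/-- Run `A`, then `B` on fresh registers, and apply `g` to the two output bits. -/
def combine (A B : QuantumAlgorithm n m) (g : Bool → Bool → Bool) : QuantumAlgorithm n m where
  W := A.W × BasisState n m B.W
  queries := A.queries + B.queries
  start := (firstActive n m A.W B.W).symm (A.start, B.start)
  U := combineU A B
  output p := g (A.output (secondActive n m A.W B.W p).1) (B.output (secondActive n m A.W B.W p).2)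

theorem oracle_mulVec_firstActive [NeZero m] {V W : Type} [Fintype V] [DecidableEq V] [Fintype W]
    [DecidableEq W] (x : Fin n → Fin m) (u : BasisState n m V → ℂ) (v : BasisState n m W → ℂ) :
    (oracle x).mulVec
        (fun p => u (firstActive n m V W p).1 * v (firstActive n m V W p).2) =
      fun p => (oracle x).mulVec u (firstActive n m V W p).1 * v (firstActive n m V W p).2 := by
  ext p
  simp only [oracle_mulVec, firstActive, Equiv.coe_fn_mk]

theorem oracle_mulVec_secondActive [NeZero m] {V W : Type} [Fintype V] [DecidableEq V] [Fintype W]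
    [DecidableEq W] (x : Fin n → Fin m) (u : BasisState n m V → ℂ) (v : BasisState n m W → ℂ) :
    (oracle x).mulVec
        (fun p => u (secondActive n m V W p).1 * v (secondActive n m V W p).2) =
      fun p => u (secondActive n m V W p).1 * (oracle x).mulVec v (secondActive n m V W p).2 := by
  ext p
  simp only [oracle_mulVec, secondActive, Equiv.coe_fn_mk]

theorem single_symm_pair {α β γ : Type*} [DecidableEq α] [DecidableEq β] [DecidableEq γ]
    (e : γ ≃ α × β) (a : α) (b : β) :
    (Pi.single (e.symm (a, b)) 1 : γ → ℂ) =
      fun p => (Pi.single a 1 : α → ℂ) (e p).1 * (Pi.single b 1 : β → ℂ) (e p).2 := by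
  ext p
  simp only [Pi.single_apply, Equiv.eq_symm_apply, Prod.ext_iff, ite_and, mul_ite, mul_one,
    mul_zero]
  split_ifs <;> simp_all

theorem evolve_combineU_of_lt [NeZero m] (A B : QuantumAlgorithm n m) (x : Fin n → Fin m) (t : ℕ)
    (ht : t < A.queries) :
    evolve (combineU A B) ((firstActive n m A.W B.W).symm (A.start, B.start)) x t =
      fun p => A.state x t (firstActive n m A.W B.W p).1 *
        (Pi.single B.start 1 : BasisState n m B.W → ℂ) (firstActive n m A.W B.W p).2 := by
  have hU : combineU A B t =
      kroneckerUnitary (firstActive n m A.W B.W) (firstActive n m A.W B.W) (A.U t) 1 := if_pos ht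
  induction t with
  | zero =>
    rw [evolve, hU]
    simp only [kroneckerUnitary, OneMemClass.coe_one]
    rw [single_symm_pair, kronecker_submatrix_mulVec, Matrix.one_mulVec]
    rfl
  | succ t ih =>
    rw [evolve, hU, ih (by omega) (if_pos (by omega))]
    simp only [kroneckerUnitary, OneMemClass.coe_one]
    rw [oracle_mulVec_firstActive, kronecker_submatrix_mulVec, Matrix.one_mulVec]
    rfl

theorem evolve_combineU_add [NeZero m] (A B : QuantumAlgorithm n m) (x : Fin n → Fin m) (s : ℕ) :
    evolve (combineU A B) ((firstActive n m A.W B.W).symm (A.start, B.start)) x (A.queries + s) =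
      fun p => A.state x A.queries (secondActive n m A.W B.W p).1 *
        B.state x s (secondActive n m A.W B.W p).2 := by
  induction s with
  | zero =>
    rw [add_zero]
    have hU : combineU A B A.queries =
        kroneckerUnitary (secondActive n m A.W B.W) (firstActive n m A.W B.W)
          (A.U A.queries) (B.U 0) :=
      (if_neg (lt_irrefl _)).trans (if_pos rfl)
    rcases hq : A.queries with _ | t
    · rw [hq] at hU
      rw [evolve, hU]
      simp only [kroneckerUnitary]
      rw [single_symm_pair, kronecker_submatrix_mulVec]
      rfl
    · rw [hq] at hU
      rw [evolve, hU, evolve_combineU_of_lt A B x t (by omega)]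
      simp only [kroneckerUnitary]
      rw [oracle_mulVec_firstActive, kronecker_submatrix_mulVec]
      rfl
  | succ s ih =>
    have hU : combineU A B (A.queries + s + 1) =
        kroneckerUnitary (secondActive n m A.W B.W) (secondActive n m A.W B.W) 1 (B.U (s + 1)) := by
      refine (if_neg (by omega)).trans ((if_neg (by omega)).trans ?_)
      rw [show A.queries + s + 1 - A.queries = s + 1 by omega]
    rw [← add_assoc, evolve, hU, ih]
    simp only [kroneckerUnitary, OneMemClass.coe_one]
    rw [oracle_mulVec_secondActive, kronecker_submatrix_mulVec, Matrix.one_mulVec]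
    rfl

/-- The two output bits of a combined algorithm are independent. -/
theorem outputProb_combine [NeZero m] (A B : QuantumAlgorithm n m) (g : Bool → Bool → Bool)
    (x : Fin n → Fin m) (c : Bool) :
    (A.combine B g).outputProb x c =
      ∑ a, ∑ b, if g a b = c then A.outputProb x a * B.outputProb x b else 0 := by
  have h : (A.combine B g).outputProb x c = ∑ p, ∑ q, if g (A.output p) (B.output q) = c then
      ‖A.state x A.queries p‖ ^ 2 * ‖B.state x B.queries q‖ ^ 2 else 0 := by
    rw [combine, outputProb_mk, evolve_combineU_add, ← Fintype.sum_prod_type',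
      ← (secondActive n m A.W B.W).sum_comp]
    exact Finset.sum_congr rfl fun p _ => by simp only [norm_mul, mul_pow]
  rw [h]
  have h2 (a b : Bool) : (if g a b = c then A.outputProb x a * B.outputProb x b else 0) =
      ∑ p, ∑ q, if g a b = c ∧ A.output p = a ∧ B.output q = b then
        ‖A.state x A.queries p‖ ^ 2 * ‖B.state x B.queries q‖ ^ 2 else 0 := by
    rw [outputProb, outputProb, Finset.sum_mul_sum]
    split_ifs with hg
    · exact Finset.sum_congr rfl fun p _ => Finset.sum_congr rfl fun q _ => by
        split_ifs <;> simp_all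
    · simp [hg]
  simp only [h2, Fintype.sum_bool, ← Finset.sum_add_distrib]
  exact Finset.sum_congr rfl fun p _ => Finset.sum_congr rfl fun q _ => by
    cases A.output p <;> cases B.output q <;> simp

/-! ### Averaging an algorithm over relabellings of the positions -/

/-- A basis state whose workspace stores a permutation `τ ∈ G`, seen as `τ` and the basis state of
the original machine whose query index is moved by `τ⁻¹`. Under this identification, querying `x`
amounts to querying `x ∘ τ`. -/
def relabelEquiv (m : ℕ) (W : Type) (G : Subgroup (Equiv.Perm (Fin n))) :
    BasisState n m (W × G) ≃ BasisState n m W × G where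
  toFun p := (((p.2.2.2 : Equiv.Perm (Fin n))⁻¹ p.1, p.2.1, p.2.2.1), p.2.2.2)
  invFun q := ((q.2 : Equiv.Perm (Fin n)) q.1.1, q.1.2.1, q.1.2.2, q.2)
  left_inv p := by simp
  right_inv q := by simp

/-- The unitaries of `A` controlled by a permutation in the workspace. The first step also applies
`Q` to the register holding that permutation. -/
def relabelU (A : QuantumAlgorithm n m) (G : Subgroup (Equiv.Perm (Fin n))) [Fintype G]
    (Q : Matrix.unitaryGroup G ℂ) (t : ℕ) :
    Matrix.unitaryGroup (BasisState n m (A.W × G)) ℂ :=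
  kroneckerUnitary (relabelEquiv m A.W G) (relabelEquiv m A.W G) (A.U t) (if t = 0 then Q else 1)

theorem evolve_relabelU [NeZero m] (A : QuantumAlgorithm n m) (G : Subgroup (Equiv.Perm (Fin n)))
    [Fintype G] (Q : Matrix.unitaryGroup G ℂ) (x : Fin n → Fin m) (t : ℕ) :
    evolve (relabelU A G Q) ((relabelEquiv m A.W G).symm (A.start, 1)) x t =
      fun p => A.state (x ∘ ((relabelEquiv m A.W G p).2 : Equiv.Perm (Fin n))) t
        (relabelEquiv m A.W G p).1 * (Q : Matrix G G ℂ) (relabelEquiv m A.W G p).2 1 := by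
  induction t with
  | zero =>
    rw [evolve, relabelU, if_pos rfl]
    simp only [kroneckerUnitary]
    rw [single_symm_pair, kronecker_submatrix_mulVec]
    ext p
    simp only [Matrix.mulVec_single_one, Matrix.col_apply, state]
  | succ t ih =>
    have hO : (oracle x).mulVec (fun p =>
          A.state (x ∘ ((relabelEquiv m A.W G p).2 : Equiv.Perm (Fin n))) t
            (relabelEquiv m A.W G p).1 * (Q : Matrix G G ℂ) (relabelEquiv m A.W G p).2 1) =
        fun p => (fun (τ : G) s => (oracle (x ∘ (τ : Equiv.Perm (Fin n)))).mulVec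
            (A.state (x ∘ (τ : Equiv.Perm (Fin n))) t) s * (Q : Matrix G G ℂ) τ 1)
          (relabelEquiv m A.W G p).2 (relabelEquiv m A.W G p).1 := by
      ext p
      simp [oracle_mulVec, relabelEquiv]
    rw [evolve, relabelU, if_neg (Nat.succ_ne_zero t), ih, hO]
    simp only [kroneckerUnitary, OneMemClass.coe_one]
    rw [kronecker_one_submatrix_mulVec (A.U (t + 1) : Matrix _ _ ℂ) (relabelEquiv m A.W G)
      (fun (τ : G) s => (oracle (x ∘ (τ : Equiv.Perm (Fin n)))).mulVec
            (A.state (x ∘ (τ : Equiv.Perm (Fin n))) t) s * (Q : Matrix G G ℂ) τ 1)]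
    ext p
    simp only [state, Matrix.mulVec, dotProduct, Finset.sum_mul, mul_assoc]

/-- Running an algorithm on `x ∘ τ`, for `τ` drawn uniformly from `G`, costs no extra queries. -/
theorem exists_average [NeZero m] (A : QuantumAlgorithm n m) (G : Subgroup (Equiv.Perm (Fin n)))
    [Fintype G] :
    ∃ B : QuantumAlgorithm n m, B.queries = A.queries ∧ ∀ x b, B.outputProb x b =
      (∑ τ : G, A.outputProb (x ∘ (τ : Equiv.Perm (Fin n))) b) / Fintype.card G := by
  have hpos : (0 : ℝ) < Fintype.card G := by exact_mod_cast Fintype.card_pos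
  have hnorm : ‖(((√(Fintype.card G : ℝ))⁻¹ : ℝ) : ℂ)‖ ^ 2 = (Fintype.card G : ℝ)⁻¹ := by
    rw [Complex.norm_real, Real.norm_eq_abs, sq_abs, inv_pow, Real.sq_sqrt hpos.le]
  obtain ⟨Q, hQ, hcol⟩ := exists_unitary_column (1 : G)
    (fun _ => (((√(Fintype.card G : ℝ))⁻¹ : ℝ) : ℂ)) (by
      simp only [hnorm, Finset.sum_const, Finset.card_univ, nsmul_eq_mul]
      exact mul_inv_cancel₀ hpos.ne')
  refine ⟨⟨A.W × G, A.queries, (relabelEquiv m A.W G).symm (A.start, 1), relabelU A G ⟨Q, hQ⟩,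
    fun p => A.output (relabelEquiv m A.W G p).1⟩, rfl, fun x b => ?_⟩
  rw [outputProb_mk, evolve_relabelU,
    (relabelEquiv m A.W G).sum_comp (fun q : BasisState n m A.W × G => if A.output q.1 = b then
      ‖A.state (x ∘ (q.2 : Equiv.Perm (Fin n))) A.queries q.1 * Q q.2 1‖ ^ 2 else 0),
    Fintype.sum_prod_type_right, Finset.sum_div]
  refine Finset.sum_congr rfl fun τ _ => ?_
  rw [outputProb, Finset.sum_div]
  refine Finset.sum_congr rfl fun s _ => ?_
  simp only [hcol, norm_mul, mul_pow, hnorm, ite_mul, zero_mul, div_eq_mul_inv]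

/-! ### Amplification -/

/-- Four runs suffice to restore error `1/3`: taking the disjunction of two conjunctions of two
runs turns an acceptance probability of at least `2/3 - 1/256` into at least `2/3`, and keeps one
of at most `1/3` below `1/3`. -/
theorem exists_amplified [NeZero m] (A : QuantumAlgorithm n m) :
    ∃ B : QuantumAlgorithm n m, B.queries = 4 * A.queries ∧ ∀ x,
      (2 / 3 - 1 / 256 ≤ A.outputProb x true → 2 / 3 ≤ B.outputProb x true) ∧
      (2 / 3 ≤ A.outputProb x false → 2 / 3 ≤ B.outputProb x false) := by
  refine ⟨(A.combine A and).combine (A.combine A and) or, ?_, fun x => ?_⟩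
  · simp only [combine]; ring
  have h := A.outputProb_add_outputProb x
  have h1 := A.outputProb_nonneg x true
  have h0 := A.outputProb_nonneg x false
  simp only [outputProb_combine, Fintype.sum_bool, Bool.and_true, Bool.and_false, Bool.or_true,
    Bool.or_false, if_true, if_false, Bool.true_eq_false, Bool.false_eq_true, add_zero, zero_add]
  rw [show A.outputProb x false = 1 - A.outputProb x true by linarith] at *
  generalize A.outputProb x true = p at *
  constructor
  · intro hp
    -- `109 / 250` lies below `(2 / 3 - 1 / 256) ^ 2`, and `1 - (1 - 109 / 250) ^ 2` above `2 / 3`.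
    have hp2 : (109 / 250 : ℝ) ≤ p * p := by nlinarith
    have hp3 : p * p ≤ 1 := by nlinarith
    nlinarith
  · intro hp
    have hp2 : p * p ≤ 1 / 9 := by nlinarith
    have hp3 : 0 ≤ p * p := by positivity
    nlinarith

/-! ### Acceptance probabilities as sums over query paths -/

/-- The part of a query in which position `a` is asked and the answer is `j`. -/
def queryAnswer {W : Type} (a : Fin n) (j : Fin m) (v : BasisState n m W → ℂ) :
    BasisState n m W → ℂ :=
  fun p => if p.1 = a then v (p.1, p.2.1 - j, p.2.2) else 0

theorem sum_norm_sq_queryAnswer_le [NeZero m] {W : Type} [Fintype W] (a : Fin n) (j : Fin m)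
    (v : BasisState n m W → ℂ) : ∑ p, ‖queryAnswer a j v p‖ ^ 2 ≤ ∑ p, ‖v p‖ ^ 2 := by
  simp only [queryAnswer, Fintype.sum_prod_type]
  refine Finset.sum_le_sum fun i _ => ?_
  rw [← (Equiv.subRight j).sum_comp fun b => ∑ w, ‖v (i, b, w)‖ ^ 2]
  refine Finset.sum_le_sum fun b _ => Finset.sum_le_sum fun w _ => ?_
  change ‖if i = a then v (i, b - j, w) else 0‖ ^ 2 ≤ ‖v (i, b - j, w)‖ ^ 2
  split_ifs
  · exact le_rfl
  · simp

theorem oracle_mulVec_eq_sum [NeZero m] {W : Type} [Fintype W] [DecidableEq W]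
    (x : Fin n → Fin m) (v : BasisState n m W → ℂ) :
    (oracle x).mulVec v = ∑ a, queryAnswer a (x a) v := by
  ext p
  rw [oracle_mulVec, Finset.sum_apply]
  simp [queryAnswer]

/-- The unnormalized state after `t` queries along the path on which the positions `i` are asked and
the answers `j` are received, the latest query coming first. It does not depend on an input. -/
def pathState (A : QuantumAlgorithm n m) :
    (t : ℕ) → (Fin t → Fin n) → (Fin t → Fin m) → BasisState n m A.W → ℂ
  | 0, _, _ => (A.U 0 : Matrix _ _ ℂ).mulVec (Pi.single A.start 1)
  | t + 1, i, j => (A.U (t + 1) : Matrix _ _ ℂ).mulVec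
      (queryAnswer (i 0) (j 0) (A.pathState t (Fin.tail i) (Fin.tail j)))

theorem sum_norm_sq_pathState_le [NeZero m] (A : QuantumAlgorithm n m) (t : ℕ) (i : Fin t → Fin n)
    (j : Fin t → Fin m) : ∑ p, ‖A.pathState t i j p‖ ^ 2 ≤ 1 := by
  induction t with
  | zero =>
    rw [pathState, sum_norm_sq_mulVec (A.U 0).2]
    simp [Pi.single_apply, apply_ite]
  | succ t ih =>
    rw [pathState, sum_norm_sq_mulVec (A.U (t + 1)).2]
    exact (sum_norm_sq_queryAnswer_le _ _ _).trans (ih _ _)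

/-- On input `x`, only the paths whose answers agree with `x` contribute to the state. -/
theorem state_eq_sum_pathState [NeZero m] (A : QuantumAlgorithm n m) (x : Fin n → Fin m) (t : ℕ) :
    A.state x t = ∑ i : Fin t → Fin n, A.pathState t i (x ∘ i) := by
  induction t with
  | zero => simp [state, pathState]
  | succ t ih =>
    rw [← (Fin.consEquiv fun _ : Fin (t + 1) => Fin n).sum_comp, Fintype.sum_prod_type, state,
      oracle_mulVec_eq_sum, Matrix.mulVec_sum]
    refine Finset.sum_congr rfl fun a _ => ?_
    have h : queryAnswer a (x a) (A.state x t) =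
        ∑ i : Fin t → Fin n, queryAnswer a (x a) (A.pathState t i (x ∘ i)) := by
      ext p
      rw [ih, Finset.sum_apply]
      simp only [queryAnswer, Finset.sum_apply]
      split_ifs <;> simp
    rw [h, Matrix.mulVec_sum]
    rfl

/-- The acceptance probability after `T` queries is a combination, with coefficients of modulus at
most `1`, of the indicators of the events that `x` sends `2T` given positions to given symbols. -/
theorem exists_outputProb_eq_sum [NeZero m] (A : QuantumAlgorithm n m) (c : Bool) :
    ∃ β : (Fin (A.queries + A.queries) → Fin n) → (Fin (A.queries + A.queries) → Fin m) → ℂ,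
      (∀ i j, ‖β i j‖ ≤ 1) ∧ ∀ x, (A.outputProb x c : ℂ) = ∑ i, β i (x ∘ i) := by
  let e (l : ℕ) := (Fin.appendEquiv (α := Fin l) A.queries A.queries).symm
  refine ⟨fun i j => ∑ q, if A.output q = c then
    (starRingEnd ℂ) (A.pathState A.queries (e n i).1 (e m j).1 q) *
      A.pathState A.queries (e n i).2 (e m j).2 q else 0, fun i j => ?_, fun x => ?_⟩
  · refine (norm_sum_le _ _).trans ?_
    have hbd : ∀ q, ‖if A.output q = c then
        (starRingEnd ℂ) (A.pathState A.queries (e n i).1 (e m j).1 q) *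
          A.pathState A.queries (e n i).2 (e m j).2 q else 0‖ ≤
        (‖A.pathState A.queries (e n i).1 (e m j).1 q‖ ^ 2 +
          ‖A.pathState A.queries (e n i).2 (e m j).2 q‖ ^ 2) / 2 := by
      intro q
      split_ifs
      · rw [norm_mul, RCLike.norm_conj]
        nlinarith [sq_nonneg (‖A.pathState A.queries (e n i).1 (e m j).1 q‖ -
          ‖A.pathState A.queries (e n i).2 (e m j).2 q‖)]
      · rw [norm_zero]; positivity
    refine (Finset.sum_le_sum fun q _ => hbd q).trans ?_
    rw [← Finset.sum_div, Finset.sum_add_distrib]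
    linarith [A.sum_norm_sq_pathState_le A.queries (e n i).1 (e m j).1,
      A.sum_norm_sq_pathState_le A.queries (e n i).2 (e m j).2]
  · have hsq (q) : ((‖A.state x A.queries q‖ ^ 2 : ℝ) : ℂ) =
        ∑ i, ∑ i', (starRingEnd ℂ) (A.pathState A.queries i (x ∘ i) q) *
          A.pathState A.queries i' (x ∘ i') q := by
      rw [Complex.ofReal_pow, ← Complex.conj_mul', state_eq_sum_pathState, Finset.sum_apply,
        map_sum, Finset.sum_mul_sum]
    rw [Finset.sum_comm, outputProb, Complex.ofReal_sum]
    refine Finset.sum_congr rfl fun q _ => ?_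
    split_ifs
    · rw [hsq, ← Fintype.sum_prod_type', ← (e n).sum_comp]
      rfl
    · simp

end QuantumAlgorithm

/-! ### Expectations over similar-looking groups -/

/-- The uniform average over `G` of a sum over query paths depends on `G` only through `mapProb`. -/
theorem sum_comp_perm_div_card {n d : ℕ} (G : Subgroup (Equiv.Perm (Fin n))) [Fintype G]
    (β : (Fin d → Fin n) → (Fin d → Fin n) → ℂ) :
    (∑ π : G, ∑ i, β i ((π : Equiv.Perm (Fin n)) ∘ i)) / Fintype.card G =
      ∑ i, ∑ j, β i j * mapProb G i j := by
  rw [Finset.sum_comm, Finset.sum_div]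
  refine Finset.sum_congr rfl fun i _ => ?_
  have hcard (j : Fin d → Fin n) : (Nat.card {π : G // ∀ l, (π : Equiv.Perm (Fin n)) (i l) = j l} :
      ℂ) = ∑ π : G, if j = (π : Equiv.Perm (Fin n)) ∘ i then 1 else 0 := by
    rw [Nat.card_eq_fintype_card, Fintype.card_subtype, Finset.sum_boole]
    congr 2
    ext π
    simp [funext_iff, eq_comm]
  simp only [mapProb, Complex.ofReal_div, Complex.ofReal_natCast, Nat.card_eq_fintype_card (α := G),
    ← mul_div_assoc, ← Finset.sum_div, hcard, Finset.mul_sum]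
  rw [Finset.sum_comm]
  simp

/-- Similarity for `k` positions entails similarity, with the same bound, for fewer positions: the
last position may be repeated. -/
theorem SimilarLooking.abs_mapProb_sub_le {n k d : ℕ} {G H : Subgroup (Equiv.Perm (Fin n))}
    (h : SimilarLooking k G H) (hd : d ≤ k) (i j : Fin d → Fin n) :
    |mapProb G i j - mapProb H i j| ≤ (n : ℝ) ^ (-(10 * (k : ℤ))) := by
  have hone (K : Subgroup (Equiv.Perm (Fin n))) (i j : Fin 0 → Fin n) : mapProb K i j = 1 := by
    have : (Nat.card K : ℝ) ≠ 0 := by exact_mod_cast Nat.card_pos.ne'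
    rw [mapProb, Nat.card_congr (Equiv.subtypeUnivEquiv fun π l => l.elim0), div_self this]
  rcases d with _ | d
  · rw [hone, hone, sub_self, abs_zero]
    positivity
  · let e : Fin k → Fin (d + 1) := fun l => ⟨min l d, by omega⟩
    have he (l : Fin (d + 1)) : e ⟨l, by omega⟩ = l := by
      ext; simp only [e]; omega
    have hpad (K : Subgroup (Equiv.Perm (Fin n))) : mapProb K (i ∘ e) (j ∘ e) = mapProb K i j := by
      rw [mapProb, mapProb]
      congr 2
      refine Nat.card_congr (Equiv.subtypeEquivRight fun π => ⟨fun hπ l => ?_, fun hπ l => hπ _⟩)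
      simpa only [Function.comp_apply, he] using hπ ⟨l, by omega⟩
    rw [← hpad G, ← hpad H]
    exact h _ _

/-- An algorithm with at most `k / 2` queries has almost the same average acceptance probability on
two similar-looking groups. -/
theorem SimilarLooking.average_outputProb_sub_le {n k : ℕ} {G H : Subgroup (Equiv.Perm (Fin n))}
    [Fintype G] [Fintype H] (h : SimilarLooking k G H) (hn : 2 ≤ n) (hk : 0 < k)
    (A : QuantumAlgorithm n n) (hA : 2 * A.queries ≤ k) (c : Bool) :
    (∑ π : H, A.outputProb (π : Equiv.Perm (Fin n)) c) / Fintype.card H - 1 / 256 ≤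
      (∑ π : G, A.outputProb (π : Equiv.Perm (Fin n)) c) / Fintype.card G := by
  have : NeZero n := ⟨by omega⟩
  obtain ⟨β, hβ, hsum⟩ := A.exists_outputProb_eq_sum c
  have key (K : Subgroup (Equiv.Perm (Fin n))) [Fintype K] :
      (((∑ π : K, A.outputProb (π : Equiv.Perm (Fin n)) c) / Fintype.card K : ℝ) : ℂ) =
        ∑ i, ∑ j, β i j * mapProb K i j := by
    rw [← sum_comp_perm_div_card]
    push_cast
    simp only [hsum]
  have hn1 : (1 : ℝ) ≤ n := by exact_mod_cast (by omega : 1 ≤ n)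
  have hdiff : |(∑ π : H, A.outputProb (π : Equiv.Perm (Fin n)) c) / Fintype.card H -
      (∑ π : G, A.outputProb (π : Equiv.Perm (Fin n)) c) / Fintype.card G| ≤
      ((n : ℝ) ^ k * (n : ℝ) ^ k) * (n : ℝ) ^ (-(10 * (k : ℤ))) := by
    rw [abs_sub_comm, ← Real.norm_eq_abs, ← Complex.norm_real, Complex.ofReal_sub, key, key,
      ← Finset.sum_sub_distrib]
    simp only [← Finset.sum_sub_distrib, ← mul_sub, ← Complex.ofReal_sub]
    have hterm (i j) : ‖β i j * ((mapProb G i j - mapProb H i j : ℝ) : ℂ)‖ ≤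
        (n : ℝ) ^ (-(10 * (k : ℤ))) := by
      rw [norm_mul, Complex.norm_real, Real.norm_eq_abs]
      exact (mul_le_of_le_one_left (abs_nonneg _) (hβ i j)).trans
        (h.abs_mapProb_sub_le (by omega) i j)
    refine (norm_sum_le_of_le _ fun i _ => norm_sum_le_of_le _ fun j _ => hterm i j).trans ?_
    simp only [Finset.sum_const, Finset.card_univ, Fintype.card_fun, Fintype.card_fin,
      nsmul_eq_mul, Nat.cast_pow]
    rw [← mul_assoc]
    have : (n : ℝ) ^ (A.queries + A.queries) ≤ (n : ℝ) ^ k := pow_le_pow_right₀ hn1 (by omega)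
    gcongr
  have hsmall : ((n : ℝ) ^ k * (n : ℝ) ^ k) * (n : ℝ) ^ (-(10 * (k : ℤ))) ≤ 1 / 256 := by
    have hn0 : (n : ℝ) ≠ 0 := by positivity
    have h8 : (256 : ℝ) ≤ (n : ℝ) ^ (8 * k) :=
      calc (256 : ℝ) = 2 ^ 8 := by norm_num
        _ ≤ (n : ℝ) ^ 8 := by gcongr; exact_mod_cast hn
        _ ≤ (n : ℝ) ^ (8 * k) := pow_le_pow_right₀ hn1 (by omega)
    rw [show (n : ℝ) ^ k * (n : ℝ) ^ k * (n : ℝ) ^ (-(10 * (k : ℤ))) = 1 / (n : ℝ) ^ (8 * k) by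
      rw [eq_div_iff (by positivity), zpow_neg, mul_right_comm, ← pow_add, ← pow_add,
        show k + k + 8 * k = 10 * k by ring,
        show ((10 : ℤ) * (k : ℤ)) = ((10 * k : ℕ) : ℤ) by push_cast; rfl, zpow_natCast]
      exact mul_inv_cancel₀ (by positivity)]
    gcongr
  linarith [(abs_le.mp (hdiff.trans hsmall)).2]

/-! ### Transferring algorithms and costs -/

theorem permStrings_disjoint_smallRange {n r : ℕ} (hr : r < n)
    (G : Subgroup (Equiv.Perm (Fin n))) {x : Fin n → Fin n} (hx : x ∈ smallRange n r) :
    x ∉ permStrings G := by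
  rintro ⟨π, -, rfl⟩
  have : (Set.range π).ncard ≤ r := hx
  rw [π.surjective.range_eq, Set.ncard_univ, Nat.card_eq_fintype_card, Fintype.card_fin] at this
  omega

theorem comp_mem_smallRange {n r : ℕ} {x : Fin n → Fin n} (hx : x ∈ smallRange n r)
    (f : Fin n → Fin n) : x ∘ f ∈ smallRange n r :=
  (Set.ncard_le_ncard (Set.range_comp_subset_range f x) (Set.finite_range x)).trans hx

theorem computes_distinguish_iff {n r : ℕ} (hr : r < n) (G : Subgroup (Equiv.Perm (Fin n)))
    (A : QuantumAlgorithm n n) (ε : ℝ) :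
    A.Computes ε (distinguish G r) ↔
      (∀ π ∈ G, 1 - ε ≤ A.outputProb π true) ∧
        ∀ x ∈ smallRange n r, 1 - ε ≤ A.outputProb x false := by
  have hmem (x : Fin n → Fin n) (b : Bool) : b ∈ distinguish G r x ↔
      (x ∈ permStrings G ∧ b = true) ∨ (x ∈ smallRange n r ∧ b = false) := by
    have := permStrings_disjoint_smallRange hr G (x := x)
    simp only [distinguish, Part.mem_mk_iff, Set.mem_union]
    by_cases hG : x ∈ permStrings G <;> by_cases hD : x ∈ smallRange n r <;>
      simp_all [eq_comm]
  simp only [QuantumAlgorithm.Computes, hmem]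
  constructor
  · intro h
    exact ⟨fun π hπ => h _ _ (Or.inl ⟨⟨π, hπ, rfl⟩, rfl⟩), fun x hx => h _ _ (Or.inr ⟨hx, rfl⟩)⟩
  · rintro ⟨hG, hD⟩ x b (⟨⟨π, hπ, rfl⟩, rfl⟩ | ⟨hx, rfl⟩)
    · exact hG π hπ
    · exact hD x hx

/-- An algorithm for `H` with at most `k / 2` queries is turned into one for a similar-looking `G`:
average it over relabellings by `G`, then amplify. -/
theorem exists_computes_of_similarLooking {n k r : ℕ} {G H : Subgroup (Equiv.Perm (Fin n))}
    (h : SimilarLooking k G H) (hn : 2 ≤ n) (hk : 0 < k) (hr : r < n) (A : QuantumAlgorithm n n)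
    (hA : 2 * A.queries ≤ k) (hcomp : A.Computes (1 / 3) (distinguish H r)) :
    ∃ B : QuantumAlgorithm n n, B.queries = 4 * A.queries ∧
      B.Computes (1 / 3) (distinguish G r) := by
  classical
  have : NeZero n := ⟨by omega⟩
  have : Fintype G := Fintype.ofFinite G
  have : Fintype H := Fintype.ofFinite H
  rw [computes_distinguish_iff hr] at hcomp
  obtain ⟨hH, hD⟩ := hcomp
  have average_ge {K : Subgroup (Equiv.Perm (Fin n))} [Fintype K] {p : K → ℝ}
      (hp : ∀ π, 1 - 1 / 3 ≤ p π) : 2 / 3 ≤ (∑ π, p π) / Fintype.card K := by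
    have hpos : (0 : ℝ) < Fintype.card K := by exact_mod_cast Fintype.card_pos
    rw [le_div_iff₀ hpos]
    have := Finset.card_nsmul_le_sum Finset.univ p (1 - 1 / 3) fun π _ => hp π
    rw [Finset.card_univ, nsmul_eq_mul] at this
    linarith
  obtain ⟨B, hBq, hB⟩ := A.exists_average G
  obtain ⟨C, hCq, hC⟩ := B.exists_amplified
  refine ⟨C, by rw [hCq, hBq], (computes_distinguish_iff hr G C _).2 ⟨fun π hπ => ?_,
    fun x hx => ?_⟩⟩
  · norm_num
    refine (hC π).1 ?_
    -- For `π ∈ G`, the permutation `π ∘ τ` is uniform on `G` when `τ` is.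
    have hperm : ∑ τ : G, A.outputProb (π ∘ (τ : Equiv.Perm (Fin n))) true =
        ∑ τ : G, A.outputProb (τ : Equiv.Perm (Fin n)) true := by
      exact Equiv.sum_comp (Equiv.mulLeft (⟨π, hπ⟩ : G)) fun τ : G =>
        A.outputProb (τ : Equiv.Perm (Fin n)) true
    rw [hB, hperm]
    have h1 := h.average_outputProb_sub_le hn hk A hA true
    have h2 := average_ge (K := H) fun τ => hH τ τ.2
    linarith
  · norm_num
    refine (hC x).2 ?_
    rw [hB]
    exact average_ge fun τ => hD _ (comp_mem_smallRange hx _)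

/-- The cost bound in `ℕ∞`. The bound by `cost G r` covers algorithms for `H` with at most `k / 2`
queries; for all others `k` is itself less than four times the number of queries. -/
theorem min_cost_le {n k r : ℕ} {G H : Subgroup (Equiv.Perm (Fin n))} (hk : 0 < k) (hkn : k ≤ n)
    (h : SimilarLooking k G H) : min (k : ℕ∞) (cost G r) ≤ 4 * cost H r := by
  rcases lt_or_ge r n with hr | hr
  swap
  · simp [cost, costErr, hr.not_gt]
  rcases (by omega : n = 1 ∨ 2 ≤ n) with rfl | hn
  · -- The bound `n ^ (-10 * k)` says nothing here, but there is only one group.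
    rw [Subsingleton.elim G H]
    exact (min_le_right _ _).trans (le_mul_of_one_le_left' (by norm_num))
  rcases eq_or_ne (cost H r) ⊤ with htop | htop
  · simp [htop]
  obtain ⟨N, hN⟩ := ENat.ne_top_iff_exists.1 htop
  have hlt : cost H r < (N + 1 : ℕ) := by rw [← hN]; exact_mod_cast Nat.lt_succ_self N
  simp only [cost, costErr, if_pos hr, quantumQueryComplexity, iInf_lt_iff] at hlt
  obtain ⟨A, hA, hAN⟩ := hlt
  have hAN : A.queries ≤ N := Nat.lt_succ_iff.1 (by exact_mod_cast hAN)
  rw [← hN]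
  rcases le_or_gt (2 * A.queries) k with hAk | hAk
  · obtain ⟨B, hBq, hB⟩ := exists_computes_of_similarLooking h hn hk hr A hAk hA
    refine (min_le_right _ _).trans ?_
    rw [cost, costErr, if_pos hr]
    refine (iInf₂_le B hB).trans ?_
    rw [hBq]
    exact_mod_cast Nat.mul_le_mul_left 4 hAN
  · refine (min_le_left _ _).trans ?_
    exact_mod_cast (by omega : k ≤ 4 * N)

theorem ofReal_mul_min_cost_le {n k r : ℕ} {G H : Subgroup (Equiv.Perm (Fin n))} (hk : 0 < k)
    (hkn : k ≤ n) (h : SimilarLooking k G H) :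
    ENNReal.ofReal (1 / 4) * min (k : ℝ≥0∞) (cost G r : ℝ≥0∞) ≤ (cost H r : ℝ≥0∞) := by
  have h4 : min (k : ℝ≥0∞) (cost G r : ℝ≥0∞) ≤ 4 * (cost H r : ℝ≥0∞) := by
    have := ENat.toENNReal_le.2 (min_cost_le (r := r) hk hkn h)
    rw [ENat.toENNReal_mul, ENat.toENNReal_min, ENat.toENNReal_coe] at this
    exact this
  rw [ENNReal.ofReal_div_of_pos (by norm_num), ENNReal.ofReal_one, one_div, mul_comm,
    show ENNReal.ofReal 4 = 4 by norm_num, ← div_eq_mul_inv]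
  exact ENNReal.div_le_of_le_mul' h4

end QuerySym

theorem mainTheorem4 :
    (∃ c : ℝ, 0 < c ∧
      ∀ (n k r : ℕ) (G H : Subgroup (Equiv.Perm (Fin n))),
        0 < k → k ≤ n → QuerySym.SimilarLooking k G H →
        ENNReal.ofReal c * min (k : ℝ≥0∞) (QuerySym.cost G r : ℝ≥0∞) ≤
          (QuerySym.cost H r : ℝ≥0∞)) ∧
    (∀ a₁ b₁ a₂ b₂ : ℝ, 0 < a₁ → 0 < b₁ → 0 < a₂ → 0 < b₂ →
      ∃ a b : ℝ, 0 < a ∧ 0 < b ∧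
      ∀ (n k r : ℕ) (G H : Subgroup (Equiv.Perm (Fin n))),
        0 < k → k ≤ n → QuerySym.SimilarLooking k G H →
        b₁ * (n : ℝ) ^ a₁ ≤ (k : ℝ) →
        ENNReal.ofReal (b₂ * (r : ℝ) ^ a₂) ≤ (QuerySym.cost G r : ℝ≥0∞) →
        ENNReal.ofReal (b * (r : ℝ) ^ a) ≤ (QuerySym.cost H r : ℝ≥0∞)) := by
  refine ⟨⟨1 / 4, by norm_num, fun n k r G H hk hkn h =>
    QuerySym.ofReal_mul_min_cost_le hk hkn h⟩, fun a₁ b₁ a₂ b₂ ha₁ hb₁ ha₂ hb₂ =>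
    ⟨min a₁ a₂, 1 / 4 * min b₁ b₂, lt_min ha₁ ha₂, by have := lt_min hb₁ hb₂; positivity,
    fun n k r G H hk hkn h hkb hG => ?_⟩⟩
  have ha : 0 < min a₁ a₂ := lt_min ha₁ ha₂
  have hb : 0 < min b₁ b₂ := lt_min hb₁ hb₂
  -- For `n ≤ r` the cost is infinite; otherwise `n` may be replaced by the smaller `r`.
  rcases lt_or_ge r n with hr | hr
  swap
  · simp [QuerySym.cost, QuerySym.costErr, hr.not_gt]
  rcases Nat.eq_zero_or_pos r with rfl | hr0
  · simp [Real.zero_rpow ha.ne']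
  have hr1 : (1 : ℝ) ≤ r := by exact_mod_cast hr0
  rw [mul_assoc, ENNReal.ofReal_mul (by norm_num)]
  refine le_trans ?_ (QuerySym.ofReal_mul_min_cost_le (r := r) hk hkn h)
  gcongr
  refine le_min ?_ (le_trans (ENNReal.ofReal_le_ofReal ?_) hG)
  · rw [← ENNReal.ofReal_natCast k]
    refine ENNReal.ofReal_le_ofReal (le_trans ?_ hkb)
    have hrn : (r : ℝ) ≤ n := by exact_mod_cast hr.le
    calc min b₁ b₂ * (r : ℝ) ^ min a₁ a₂ ≤ b₁ * (r : ℝ) ^ a₁ := by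
          gcongr
          · exact min_le_left _ _
          · exact min_le_left _ _
      _ ≤ b₁ * (n : ℝ) ^ a₁ := by gcongr
  · gcongr
    · exact min_le_right _ _
    · exact min_le_right _ _
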